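/- Let $N, M\ge 0$ be integers and let $\Theta$ be the square linear system $\dot x=\widehat A x+\widehat B u$, $y=\widehat C x+\widehat D u$ with real matrices $\widehat A\in\mathbb R^{N\times N}$, $\widehat B\in\mathbb R^{N\times M}$, $\widehat C\in\mathbb R^{M\times N}$, $\widehat D\in\mathbb R^{M\times M}$. Assume that its transfer matrix $\widehat G(s)=\widehat C(sI_N-\widehat A)^{-1}\widehat B+\widehat D$ is invertible over the field $\mathbb R(s)$. Let $N_s$ be the degree of the numerator of $\det\widehat G(s)$ before any pole-zero cancellation, that is, the degree of the polynomial $\det(sI_N-\widehat A)\,\det\widehat G(s)\in\mathbb R[s]$. The weakly unobservable subspace $\mathcal W_u\subseteq\mathbb R^N$ consists of the states $x_0$ for which there is an input $u:[0,\infty)\to\mathbb R^M$, the restriction of a $C^\infty$ function on $\mathbb R$, such that the output resulting from the initial state $x(0)=x_0$ and the input $u$ vanishes for all $t\ge 0$. An impulsive-smooth distribution is a distribution on $\mathbb R$ of the form $f|_{\mathbb R_+}+\sum_{i=0}^k a_i\delta^{(i)}$, where $f$ is a $C^\infty$ function on $\mathbb R$, $f|_{\mathbb R_+}$ is its restriction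 to the positive half-line (extended by zero) and the $a_i$ are constant vectors; its value at $0^+$ is $f(0)$. The strongly reachable subspace $\mathcal S_r\subseteq\mathbb R^N$ consists of the states $x_1$ for which there is an impulsive-smooth input $u$ such that the impulsive-smooth state trajectory $x$ starting from the origin (the solution of $\dot x=\widehat Ax+\widehat Bu$ in the sense of distributions) has $x(0^+)=x_1$ and the output $y=\widehat Cx+\widehat Du$ has no impulsive part, i.e. $y=g|_{\mathbb R_+}$ for some $C^\infty$ function $g$. Then: 1. $\dim\mathcal W_u=N_s$; 2. $\dim\mathcal S_r=N-N_s$. -/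

import Mathlib

open MeasureTheory Set Polynomial
open scoped ContDiff Distributions LineDeriv

noncomputable section

/-! ### Impulsive-smooth distributions -/

/-- Distributions on the real line with values in `ℝⁿ`. -/
abbrev VDist (n : ℕ) : Type := 𝓓'((⊤ : TopologicalSpace.Opens ℝ), Fin n → ℝ)

/-- The regular distribution `φ ↦ ∫_{(0, ∞)} φ(t) f(t) dt` on the real line given by the restriction
of `f` to the positive half-line (extended by zero). It is used for smooth `f` only. -/
def regDist {n : ℕ} (f : ℝ → Fin n → ℝ) : VDist n :=
  ContinuousLinearMap.toUniformConvergenceCLM _ _ _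
    (TestFunction.integralAgainstBilinCLM (ContinuousLinearMap.lsmul ℝ ℝ)
      (volume.restrict (Ioi (0 : ℝ))) f)

/-- `a δ⁽ⁱ⁾`: the `i`-th distributional derivative of the Dirac impulse at `0`, times the vector
`a`. -/
def diracDeriv {n : ℕ} (i : ℕ) (a : Fin n → ℝ) : VDist n :=
  Distribution.mapCLM (ContinuousLinearMap.toSpanSingleton ℝ a)
    ((fun T : 𝓓'((⊤ : TopologicalSpace.Opens ℝ), ℝ) => ∂_{(1 : ℝ)} T)^[i] (Distribution.delta 0))

/-- The distribution `f|_{ℝ₊} + ∑ᵢ aᵢ δ⁽ⁱ⁾` (a finite sum). -/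
def impSmooth {n : ℕ} (f : ℝ → Fin n → ℝ) (a : ℕ →₀ (Fin n → ℝ)) : VDist n :=
  regDist f + a.sum diracDeriv

/-- `T` belongs to the set of impulsive-smooth distributions. -/
def IsImpulsiveSmooth {n : ℕ} (T : VDist n) : Prop :=
  ∃ (f : ℝ → Fin n → ℝ) (a : ℕ →₀ (Fin n → ℝ)), ContDiff ℝ ∞ f ∧ T = impSmooth f a

/-- `T` is a smooth function on the half-line (no impulsive part). -/
def IsRegularDist {n : ℕ} (T : VDist n) : Prop :=
  ∃ f : ℝ → Fin n → ℝ, ContDiff ℝ ∞ f ∧ T = regDist f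

/-- `T` is impulsive-smooth and `T(0⁺) = v`, the value at `0⁺` of its smooth part. -/
def HasValueAtZeroPlus {n : ℕ} (T : VDist n) (v : Fin n → ℝ) : Prop :=
  ∃ (f : ℝ → Fin n → ℝ) (a : ℕ →₀ (Fin n → ℝ)), ContDiff ℝ ∞ f ∧ T = impSmooth f a ∧ f 0 = v

/-- Application of a constant real matrix to a vector-valued distribution. -/
def matDist {m n : ℕ} (A : Matrix (Fin m) (Fin n) ℝ) : VDist n →L[ℝ] VDist m :=
  Distribution.mapCLM (LinearMap.toContinuousLinearMap A.mulVecLin)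

theorem locInt_of_contDiff {n : ℕ} {f : ℝ → Fin n → ℝ} (hf : ContDiff ℝ ∞ f) :
    LocallyIntegrableOn f ((⊤ : TopologicalSpace.Opens ℝ) : Set ℝ) (volume.restrict (Ioi (0 : ℝ))) :=
  (hf.continuous.locallyIntegrable).locallyIntegrableOn _

theorem regDist_apply {n : ℕ} {f : ℝ → Fin n → ℝ} (hf : ContDiff ℝ ∞ f)
    (φ : 𝓓((⊤ : TopologicalSpace.Opens ℝ), ℝ)) :
    regDist f φ = ∫ t in Ioi (0 : ℝ), φ t • f t :=
  TestFunction.integralAgainstBilinCLM_eq_integral (locInt_of_contDiff hf)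

theorem regDist_add {n : ℕ} {f g : ℝ → Fin n → ℝ} (hf : ContDiff ℝ ∞ f) (hg : ContDiff ℝ ∞ g) :
    regDist (f + g) = regDist f + regDist g := by
  ext1 φ
  have h1 := TestFunction.integrable_bilin (ContinuousLinearMap.lsmul ℝ ℝ) (locInt_of_contDiff hf) φ
  have h2 := TestFunction.integrable_bilin (ContinuousLinearMap.lsmul ℝ ℝ) (locInt_of_contDiff hg) φ
  change regDist (f + g) φ = regDist f φ + regDist g φ
  simp only [ContinuousLinearMap.lsmul_apply] at h1 h2
  have h3 := regDist_apply (show ContDiff ℝ ∞ (f + g) from hf.add hg) φ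
  rw [h3, regDist_apply hf, regDist_apply hg, ← integral_add h1 h2]
  simp [smul_add]

theorem regDist_smul {n : ℕ} {f : ℝ → Fin n → ℝ} (c : ℝ) (hf : ContDiff ℝ ∞ f) :
    regDist (c • f) = c • regDist f := by
  ext1 φ
  change regDist (c • f) φ = c • regDist f φ
  have h3 := regDist_apply (show ContDiff ℝ ∞ (c • f) from hf.const_smul c) φ
  rw [h3, regDist_apply hf, ← integral_smul]
  simp [smul_comm c]

theorem diracDeriv_add {n : ℕ} (i : ℕ) (a b : Fin n → ℝ) :
    diracDeriv i (a + b) = diracDeriv i a + diracDeriv i b := by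
  ext1 φ
  change _ = diracDeriv i a φ + diracDeriv i b φ
  simp [diracDeriv]

theorem diracDeriv_smul {n : ℕ} (i : ℕ) (c : ℝ) (a : Fin n → ℝ) :
    diracDeriv i (c • a) = c • diracDeriv i a := by
  ext1 φ
  change _ = c • diracDeriv i a φ
  simp [diracDeriv, smul_comm c]

theorem diracDeriv_zero {n : ℕ} (i : ℕ) : diracDeriv i (0 : Fin n → ℝ) = 0 := by
  simpa using diracDeriv_smul i 0 (0 : Fin n → ℝ)

theorem impSmooth_add {n : ℕ} {f g : ℝ → Fin n → ℝ} (hf : ContDiff ℝ ∞ f) (hg : ContDiff ℝ ∞ g)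
    (a b : ℕ →₀ (Fin n → ℝ)) :
    impSmooth (f + g) (a + b) = impSmooth f a + impSmooth g b := by
  rw [impSmooth, regDist_add hf hg, Finsupp.sum_add_index' diracDeriv_zero diracDeriv_add]
  simp only [impSmooth]
  abel

theorem impSmooth_smul {n : ℕ} {f : ℝ → Fin n → ℝ} (c : ℝ) (hf : ContDiff ℝ ∞ f)
    (a : ℕ →₀ (Fin n → ℝ)) :
    impSmooth (c • f) (c • a) = c • impSmooth f a := by
  rw [impSmooth, regDist_smul c hf, Finsupp.sum_smul_index' diracDeriv_zero, impSmooth, smul_add,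
    Finsupp.smul_sum]
  simp [diracDeriv_smul]

theorem impSmooth_zero {n : ℕ} : impSmooth (0 : ℝ → Fin n → ℝ) 0 = 0 := by
  simpa using impSmooth_smul (0 : ℝ) (contDiff_const (c := (0 : Fin n → ℝ))) 0

/-! ### State-space systems -/

/-- The system `dx/dt = A x + B u`, `y = C x + D u` with `n` states, `m` inputs, `p` outputs. -/
structure StateSpace (n m p : ℕ) where
  /-- the state matrix -/
  A : Matrix (Fin n) (Fin n) ℝ
  /-- the input matrix -/
  B : Matrix (Fin n) (Fin m) ℝ
  /-- the output matrix -/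
  C : Matrix (Fin p) (Fin n) ℝ
  /-- the feedthrough matrix -/
  D : Matrix (Fin p) (Fin m) ℝ

namespace StateSpace

variable {n m p : ℕ}

/-- `x` is the state trajectory on `[0, ∞)` from the initial state `x₀` under the input
function `u`. -/
def IsTrajectory (S : StateSpace n m p) (x₀ : Fin n → ℝ) (u : ℝ → Fin m → ℝ)
    (x : ℝ → Fin n → ℝ) : Prop :=
  x 0 = x₀ ∧
    ∀ t ∈ Ici (0 : ℝ), HasDerivWithinAt x (S.A.mulVec (x t) + S.B.mulVec (u t)) (Ici 0) t

/-- The weakly unobservable subspace: the states `x₀` for which some smooth input makes the output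
vanish at all times `t ≥ 0`. -/
def weaklyUnobservable (S : StateSpace n m p) : Submodule ℝ (Fin n → ℝ) where
  carrier := {x₀ | ∃ u : ℝ → Fin m → ℝ, ContDiff ℝ ∞ u ∧ ∃ x : ℝ → Fin n → ℝ,
    S.IsTrajectory x₀ u x ∧ ∀ t ∈ Ici (0 : ℝ), S.C.mulVec (x t) + S.D.mulVec (u t) = 0}
  add_mem' := by
    rintro x₀ z₀ ⟨u, hu, x, ⟨hx0, hx⟩, hy⟩ ⟨v, hv, z, ⟨hz0, hz⟩, hw⟩
    refine ⟨u + v, hu.add hv, x + z, ⟨by simp [hx0, hz0], fun t ht => ?_⟩, fun t ht => ?_⟩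
    · have h := (hx t ht).add (hz t ht)
      have e : S.A.mulVec ((x + z) t) + S.B.mulVec ((u + v) t) =
          (S.A.mulVec (x t) + S.B.mulVec (u t)) + (S.A.mulVec (z t) + S.B.mulVec (v t)) := by
        simp only [Pi.add_apply, Matrix.mulVec_add]
        abel
      rw [e]
      exact h
    · have h : _ + _ = (0 : Fin p → ℝ) + 0 := congrArg₂ (· + ·) (hy t ht) (hw t ht)
      rw [add_zero] at h
      rw [← h]
      simp only [Pi.add_apply, Matrix.mulVec_add]
      abel
  zero_mem' := by
    refine ⟨0, contDiff_const, 0, ⟨rfl, fun t _ => ?_⟩, fun t _ => by simp⟩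
    have e : S.A.mulVec ((0 : ℝ → Fin n → ℝ) t) + S.B.mulVec ((0 : ℝ → Fin m → ℝ) t) = 0 := by
      simp
    rw [e]
    exact hasDerivWithinAt_const t (Ici (0 : ℝ)) (0 : Fin n → ℝ)
  smul_mem' := by
    rintro c x₀ ⟨u, hu, x, ⟨hx0, hx⟩, hy⟩
    refine ⟨c • u, hu.const_smul c, c • x, ⟨by simp [hx0], fun t ht => ?_⟩, fun t ht => ?_⟩
    · have h := (hx t ht).const_smul c
      have e : S.A.mulVec ((c • x) t) + S.B.mulVec ((c • u) t) =
          c • (S.A.mulVec (x t) + S.B.mulVec (u t)) := by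
        simp [Matrix.mulVec_smul, smul_add]
      rw [e]
      exact h
    · have h := congrArg (fun w => c • w) (hy t ht)
      simpa [Matrix.mulVec_smul, smul_add] using h

/-- The state distribution `x` satisfies `dx/dt = A x + B u + x₀ δ` in the sense of distributions,
i.e. it is the state trajectory that starts at `x₀` and is driven by the input distribution `u`
from time `0` on. -/
def IsDistTrajectory (S : StateSpace n m p) (x₀ : Fin n → ℝ) (u : VDist m) (x : VDist n) : Prop :=
  ∂_{(1 : ℝ)} x = matDist S.A x + matDist S.B u + diracDeriv 0 x₀

/-- The strongly reachable subspace: the states `x₁ = x(0⁺; 0, u)` reached from the origin by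
impulsive-smooth inputs `u` for which the output `C x + D u` has no impulsive part. -/
def stronglyReachable (S : StateSpace n m p) : Submodule ℝ (Fin n → ℝ) where
  carrier := {x₁ | ∃ (u : VDist m) (x : VDist n), IsImpulsiveSmooth u ∧
    S.IsDistTrajectory 0 u x ∧ HasValueAtZeroPlus x x₁ ∧
    IsRegularDist (matDist S.C x + matDist S.D u)}
  add_mem' := by
    rintro x₁ z₁ ⟨u, x, ⟨f, a, hf, rfl⟩, hx, ⟨g, b, hg, rfl, hg0⟩, ⟨y, hy, hy'⟩⟩
      ⟨u', x', ⟨f', a', hf', rfl⟩, hx', ⟨g', b', hg', rfl, hg0'⟩, ⟨w, hw, hw'⟩⟩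
    refine ⟨_, _, ⟨f + f', a + a', hf.add hf', rfl⟩, ?_,
      ⟨g + g', b + b', hg.add hg', rfl, by simp [hg0, hg0']⟩, ⟨y + w, hy.add hw, ?_⟩⟩
    · unfold IsDistTrajectory at *
      rw [impSmooth_add hg hg', impSmooth_add hf hf', LineDeriv.lineDerivOp_add, hx, hx', map_add,
        map_add, diracDeriv_zero]
      abel
    · rw [impSmooth_add hg hg', impSmooth_add hf hf', regDist_add hy hw, ← hy', ← hw', map_add,
        map_add]
      abel
  zero_mem' := by
    refine ⟨0, 0, ⟨0, 0, contDiff_const, impSmooth_zero.symm⟩, ?_,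
      ⟨0, 0, contDiff_const, impSmooth_zero.symm, rfl⟩, ⟨0, contDiff_const, ?_⟩⟩
    · simp [IsDistTrajectory, diracDeriv_zero, LineDeriv.lineDerivOp_zero]
    · simpa [impSmooth] using (impSmooth_zero (n := p)).symm
  smul_mem' := by
    rintro c x₁ ⟨u, x, ⟨f, a, hf, rfl⟩, hx, ⟨g, b, hg, rfl, hg0⟩, ⟨y, hy, hy'⟩⟩
    refine ⟨_, _, ⟨c • f, c • a, hf.const_smul c, rfl⟩, ?_,
      ⟨c • g, c • b, hg.const_smul c, rfl, by simp [hg0]⟩, ⟨c • y, hy.const_smul c, ?_⟩⟩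
    · unfold IsDistTrajectory at *
      rw [impSmooth_smul c hg, impSmooth_smul c hf, LineDeriv.lineDerivOp_smul, hx, map_smul,
        map_smul, diracDeriv_zero, add_zero, add_zero, smul_add]
    · rw [impSmooth_smul c hg, impSmooth_smul c hf, regDist_smul c hy, ← hy', map_smul, map_smul,
        smul_add]

/-- The transfer matrix `G(s) = C (s I - A)⁻¹ B + D` over the field `ℝ(s)`. -/
def transferMatrix (S : StateSpace n m p) : Matrix (Fin p) (Fin m) (RatFunc ℝ) :=
  S.C.map RatFunc.C * ((RatFunc.X : RatFunc ℝ) • 1 - S.A.map RatFunc.C)⁻¹ * S.B.map RatFunc.C +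
    S.D.map RatFunc.C

/-- The numerator of `det G(s)` before any pole-zero cancellation, that is, over the denominator
`det (s I - A)`: the polynomial `det (s I - A) · det G(s)`. See `det_transferMatrix_eq`. -/
def numDet (S : StateSpace n m m) : ℝ[X] :=
  (algebraMap ℝ[X] (RatFunc ℝ) S.A.charpoly * S.transferMatrix.det).num

theorem charmatrix_map (A : Matrix (Fin n) (Fin n) ℝ) :
    A.charmatrix.map (algebraMap ℝ[X] (RatFunc ℝ)) =
      (RatFunc.X : RatFunc ℝ) • 1 - A.map RatFunc.C := by
  ext i j
  by_cases h : i = j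
  · subst h; simp
  · simp [h]

/-- `det (s I - A) · det G(s)` is a polynomial, namely `numDet`. -/
theorem algebraMap_numDet (S : StateSpace n m m) :
    algebraMap ℝ[X] (RatFunc ℝ) S.numDet =
      algebraMap ℝ[X] (RatFunc ℝ) S.A.charpoly * S.transferMatrix.det := by
  suffices h : ∃ q : ℝ[X], algebraMap ℝ[X] (RatFunc ℝ) q =
      algebraMap ℝ[X] (RatFunc ℝ) S.A.charpoly * S.transferMatrix.det by
    obtain ⟨q, hq⟩ := h
    rw [numDet, ← hq, RatFunc.num_algebraMap]
  have hdet : ((RatFunc.X : RatFunc ℝ) • 1 - S.A.map RatFunc.C).det =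
      algebraMap ℝ[X] (RatFunc ℝ) S.A.charpoly := by
    rw [← charmatrix_map, Matrix.charpoly, RingHom.map_det, RingHom.mapMatrix_apply]
  have hne : algebraMap ℝ[X] (RatFunc ℝ) S.A.charpoly ≠ 0 := by
    simpa using S.A.charpoly_monic.ne_zero
  have hu : IsUnit ((RatFunc.X : RatFunc ℝ) • 1 - S.A.map RatFunc.C) := by
    rw [Matrix.isUnit_iff_isUnit_det, hdet]
    exact hne.isUnit
  let _ : Invertible ((RatFunc.X : RatFunc ℝ) • 1 - S.A.map RatFunc.C) := hu.invertible
  refine ⟨(Matrix.fromBlocks S.A.charmatrix (-(S.B.map Polynomial.C)) (S.C.map Polynomial.C)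
    (S.D.map Polynomial.C)).det, ?_⟩
  rw [RingHom.map_det, RingHom.mapMatrix_apply, Matrix.fromBlocks_map, charmatrix_map,
    Matrix.det_fromBlocks₁₁, hdet, transferMatrix, Matrix.invOf_eq_nonsing_inv]
  congr 2
  have hB : (-(S.B.map Polynomial.C)).map (algebraMap ℝ[X] (RatFunc ℝ)) = -(S.B.map RatFunc.C) := by
    ext i j; simp
  have hC : (S.C.map Polynomial.C).map (algebraMap ℝ[X] (RatFunc ℝ)) = S.C.map RatFunc.C := by
    ext i j; simp
  have hD : (S.D.map Polynomial.C).map (algebraMap ℝ[X] (RatFunc ℝ)) = S.D.map RatFunc.C := by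
    ext i j; simp
  rw [hB, hC, hD, Matrix.mul_neg, sub_neg_eq_add, add_comm]

/-- `det G(s) = numDet / det (s I - A)`. -/
theorem det_transferMatrix_eq (S : StateSpace n m m) :
    S.transferMatrix.det =
      algebraMap ℝ[X] (RatFunc ℝ) S.numDet / algebraMap ℝ[X] (RatFunc ℝ) S.A.charpoly := by
  rw [algebraMap_numDet, mul_div_cancel_left₀]
  simpa using S.A.charpoly_monic.ne_zero

end StateSpace

end

noncomputable section

/-! ### Calculus of impulsive-smooth distributions -/

/-! Put `E = diag(I, 0)` and `K = [A, B; -C, -D]`. The Schur complement gives `det (sE - K) = det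
(sI - A) · det G(s)`, so the pencil is regular and `λE - K` is invertible for some real `λ`. With `R
= -(λE - K)⁻¹E`, the relation `E a = K b` becomes `R a = b + λ R b` (`pencil_mulVec_eq_iff`), so
everything is governed by the Fitting decomposition of `R` into its generalized null space and its
eventual range.

Output-zeroing pairs `z = (x, u)` solve `E z' = K z`; their values fill exactly the eventual range.
The impulse coefficients of a trajectory from the origin form a finite chain `E sᵢ = K sᵢ₊₁` whose
head has state part `x(0⁺)`; the heads fill exactly the generalized null space. Hence
`weaklyUnobservable_eq` and `stronglyReachable_eq`: the two subspaces are the state projections of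
the two Fitting components.

The eventual range has dimension `deg det (sE - K) = N_s` (`finrank_eventualRange_pencilOp`). The
projection has the `M`-dimensional kernel `ker E`, contained in the generalized null space. It is
therefore injective on the eventual range, giving `N_s`, and costs `M` dimensions on the other
component, giving `(N + M - N_s) - M`. -/

theorem testFunction_lineDeriv_coe (φ : 𝓓((⊤ : TopologicalSpace.Opens ℝ), ℝ)) :
    ((∂_{(1 : ℝ)} φ : 𝓓((⊤ : TopologicalSpace.Opens ℝ), ℝ)) : ℝ → ℝ) = deriv φ := by
  ext t
  rw [TestFunction.lineDerivOp_eq_lineDerivCLM ℝ, TestFunction.lineDerivCLM_apply_of_le (by simp)]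
  exact (φ.contDiff.differentiable (by simp) t).lineDeriv_eq_fderiv.trans (by simp)

theorem iterate_lineDeriv_apply {F : Type*} [AddCommGroup F] [Module ℝ F] [TopologicalSpace F]
    [IsTopologicalAddGroup F] [ContinuousSMul ℝ F]
    (T : 𝓓'((⊤ : TopologicalSpace.Opens ℝ), F)) (i : ℕ)
    (φ : 𝓓((⊤ : TopologicalSpace.Opens ℝ), ℝ)) :
    ((fun S : 𝓓'((⊤ : TopologicalSpace.Opens ℝ), F) => ∂_{(1 : ℝ)} S)^[i] T) φ =
      (-1 : ℝ) ^ i • T ((fun ψ : 𝓓((⊤ : TopologicalSpace.Opens ℝ), ℝ) => ∂_{(1 : ℝ)} ψ)^[i] φ) := by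
  induction i generalizing φ with
  | zero => simp
  | succ i ih =>
    rw [Function.iterate_succ_apply', Distribution.lineDerivOp_apply_apply, map_neg, ih,
      Function.iterate_succ_apply, pow_succ]
    simp

theorem iterate_testFunction_lineDeriv_coe (i : ℕ)
    (φ : 𝓓((⊤ : TopologicalSpace.Opens ℝ), ℝ)) :
    (((fun ψ : 𝓓((⊤ : TopologicalSpace.Opens ℝ), ℝ) => ∂_{(1 : ℝ)} ψ)^[i] φ :
      𝓓((⊤ : TopologicalSpace.Opens ℝ), ℝ)) : ℝ → ℝ) = iteratedDeriv i φ := by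
  induction i with
  | zero => simp
  | succ i ih =>
    rw [Function.iterate_succ_apply', testFunction_lineDeriv_coe, ih, iteratedDeriv_succ]

theorem diracDeriv_apply {n : ℕ} (i : ℕ) (a : Fin n → ℝ)
    (φ : 𝓓((⊤ : TopologicalSpace.Opens ℝ), ℝ)) :
    diracDeriv i a φ = ((-1 : ℝ) ^ i * iteratedDeriv i φ 0) • a := by
  rw [diracDeriv, Distribution.mapCLM_apply, iterate_lineDeriv_apply, Distribution.delta_apply,
    iterate_testFunction_lineDeriv_coe]
  simp

theorem lineDeriv_diracDeriv {n : ℕ} (i : ℕ) (a : Fin n → ℝ) :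
    ∂_{(1 : ℝ)} (diracDeriv i a) = diracDeriv (i + 1) a := by
  ext1 φ
  rw [Distribution.lineDerivOp_apply_apply, map_neg, diracDeriv_apply, diracDeriv_apply,
    testFunction_lineDeriv_coe, ← iteratedDeriv_succ', pow_succ, ← neg_smul]
  congr 1
  ring

/-- Integration by parts on the positive half-line; the boundary term is the impulse produced by the
jump at `0`. -/
theorem lineDeriv_regDist {n : ℕ} {f : ℝ → Fin n → ℝ} (hf : ContDiff ℝ ∞ f) :
    ∂_{(1 : ℝ)} (regDist f) = regDist (deriv f) + diracDeriv 0 (f 0) := by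
  have hf' : ContDiff ℝ ∞ (deriv f) := (contDiff_infty_iff_deriv.1 hf).2
  ext1 φ
  change _ = regDist (deriv f) φ + diracDeriv 0 (f 0) φ
  rw [Distribution.lineDerivOp_apply_apply, map_neg, diracDeriv_apply, regDist_apply hf,
    regDist_apply hf', testFunction_lineDeriv_coe]
  have h1 := TestFunction.integrable_bilin (ContinuousLinearMap.lsmul ℝ ℝ)
    (locInt_of_contDiff hf') φ
  have h2 := TestFunction.integrable_bilin (ContinuousLinearMap.lsmul ℝ ℝ)
    (locInt_of_contDiff hf) (∂_{(1 : ℝ)} φ)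
  simp only [ContinuousLinearMap.lsmul_apply, testFunction_lineDeriv_coe] at h1 h2
  have hφ : ContDiff ℝ ∞ φ := φ.contDiff
  have h3 := (φ.hasCompactSupport.smul_right (f' := f)).integral_Ioi_deriv_eq
    (((hφ.smul hf).of_le (by simp))) 0
  have h4 : deriv ((φ : ℝ → ℝ) • f) = fun t => φ t • deriv f t + deriv φ t • f t := by
    ext1 t
    exact deriv_smul (hφ.differentiable (by simp) t) (hf.differentiable (by simp) t)
  rw [h4, integral_add h1 h2] at h3
  rw [neg_eq_iff_eq_neg, eq_comm, neg_eq_iff_eq_neg]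
  simp only [Pi.smul_apply', pow_zero, iteratedDeriv_zero, one_mul] at h3 ⊢
  rw [← neg_eq_iff_eq_neg.2 h3]
  abel

theorem lineDeriv_impSmooth {n : ℕ} {f : ℝ → Fin n → ℝ} (hf : ContDiff ℝ ∞ f)
    (a : ℕ →₀ (Fin n → ℝ)) :
    ∂_{(1 : ℝ)} (impSmooth f a) =
      impSmooth (deriv f) (Finsupp.single 0 (f 0) + a.mapDomain Nat.succ) := by
  rw [impSmooth, impSmooth, LineDeriv.lineDerivOp_add, lineDeriv_regDist hf,
    Finsupp.sum_add_index' diracDeriv_zero diracDeriv_add,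
    Finsupp.sum_single_index (diracDeriv_zero 0),
    Finsupp.sum_mapDomain_index diracDeriv_zero diracDeriv_add, add_assoc]
  congr 2
  simp only [Finsupp.sum, LineDeriv.lineDerivOp_sum, lineDeriv_diracDeriv, Nat.succ_eq_add_one]

theorem contDiff_mulVec {m n : ℕ} (A : Matrix (Fin m) (Fin n) ℝ) {f : ℝ → Fin n → ℝ}
    (hf : ContDiff ℝ ∞ f) : ContDiff ℝ ∞ fun t => A.mulVec (f t) :=
  (LinearMap.toContinuousLinearMap A.mulVecLin).contDiff.comp hf

theorem matDist_impSmooth {m n : ℕ} (A : Matrix (Fin m) (Fin n) ℝ) {f : ℝ → Fin n → ℝ}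
    (hf : ContDiff ℝ ∞ f) (a : ℕ →₀ (Fin n → ℝ)) :
    matDist A (impSmooth f a) =
      impSmooth (fun t => A.mulVec (f t)) (a.mapRange A.mulVec (Matrix.mulVec_zero A)) := by
  have h1 : matDist A (regDist f) = regDist fun t => A.mulVec (f t) := by
    ext1 φ
    rw [matDist, Distribution.mapCLM_apply, regDist_apply hf, regDist_apply (contDiff_mulVec A hf)]
    have h := TestFunction.integrable_bilin (ContinuousLinearMap.lsmul ℝ ℝ)
      (locInt_of_contDiff hf) φ
    simp only [ContinuousLinearMap.lsmul_apply] at h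
    rw [← ContinuousLinearMap.integral_comp_comm _ h]
    simp
  have h2 : ∀ i b, matDist A (diracDeriv i b) = diracDeriv i (A.mulVec b) := by
    intro i b
    ext1 φ
    rw [matDist, Distribution.mapCLM_apply, diracDeriv_apply, diracDeriv_apply]
    simp
  rw [impSmooth, impSmooth, map_add, h1, Finsupp.sum_mapRange_index diracDeriv_zero,
    map_finsuppSum]
  simp only [h2]

/-- A smooth function on the line that is compactly supported, as a test function. -/
def testFunctionOfContDiff (φ : ℝ → ℝ) (h : ContDiff ℝ ∞ φ) (hc : HasCompactSupport φ) :
    𝓓((⊤ : TopologicalSpace.Opens ℝ), ℝ) :=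
  ⟨φ, h, hc, fun _ _ => trivial⟩

theorem sum_diracDeriv_apply {n : ℕ} (a : ℕ →₀ (Fin n → ℝ))
    (φ : 𝓓((⊤ : TopologicalSpace.Opens ℝ), ℝ)) :
    a.sum diracDeriv φ = a.sum fun i b => ((-1 : ℝ) ^ i * iteratedDeriv i φ 0) • b := by
  simp only [← diracDeriv_apply]
  exact map_finsuppSum (AddMonoidHom.mk' (fun T : VDist n => T φ) fun _ _ => rfl) a diracDeriv

/-- Test functions supported in `(0, ∞)` do not see the impulses, so `f` vanishes almost everywhere
there. -/
theorem regDist_eq_zero_of_impSmooth_eq_zero {n : ℕ} {f : ℝ → Fin n → ℝ} (hf : ContDiff ℝ ∞ f)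
    {a : ℕ →₀ (Fin n → ℝ)} (h : impSmooth f a = 0) : regDist f = 0 := by
  have key : ∀ᵐ t, t ∈ Ioi (0 : ℝ) → f t = 0 := by
    refine isOpen_Ioi.ae_eq_zero_of_integral_contDiff_smul_eq_zero
      (hf.continuous.locallyIntegrable.locallyIntegrableOn _) fun g hg hgc hgs => ?_
    have h0 : ∀ i, iteratedDeriv i g 0 = 0 := fun i => by
      have : (0 : ℝ) ∉ tsupport g := fun hh => lt_irrefl (0 : ℝ) (hgs hh)
      rw [((notMem_tsupport_iff_eventuallyEq.1 this).iteratedDeriv_eq i)]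
      simp
    have h1 : impSmooth f a (testFunctionOfContDiff g hg hgc) = 0 := by rw [h]; rfl
    change regDist f _ + a.sum diracDeriv _ = 0 at h1
    rw [sum_diracDeriv_apply, regDist_apply hf] at h1
    change (∫ t in Ioi (0 : ℝ), g t • f t) + a.sum (fun i b => (_ * iteratedDeriv i g 0) • b) = 0
      at h1
    simp only [h0, mul_zero, zero_smul, Finsupp.sum_fun_zero, add_zero] at h1
    rw [← h1, ← integral_indicator measurableSet_Ioi]
    congr 1
    ext1 t
    by_cases ht : t ∈ Ioi (0 : ℝ)
    · simp [ht]
    · have : g t = 0 := image_eq_zero_of_notMem_tsupport fun hh => ht (hgs hh)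
      simp [indicator_of_notMem ht, this]
  ext1 φ
  rw [regDist_apply hf]
  refine (setIntegral_congr_ae measurableSet_Ioi (g := fun _ => 0) ?_).trans (by simp)
  filter_upwards [key] with t ht h'
  rw [ht h', smul_zero]

/-- A smooth compactly supported function that coincides with `t ^ k` near the origin. -/
theorem exists_testFunction_eq_pow (k : ℕ) :
    ∃ φ : 𝓓((⊤ : TopologicalSpace.Opens ℝ), ℝ), φ =ᶠ[nhds 0] fun t => t ^ k := by
  let b : ContDiffBump (0 : ℝ) := ⟨1, 2, one_pos, one_lt_two⟩
  refine ⟨testFunctionOfContDiff (fun t => b t * t ^ k) (b.contDiff.mul (contDiff_id.pow k))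
    b.hasCompactSupport.mul_right, ?_⟩
  filter_upwards [b.eventuallyEq_one] with t ht
  change b t * t ^ k = t ^ k
  simp [ht]

/-- Once the regular part is gone, a test function equal to `t ^ k` near `0` isolates the `k`-th
coefficient, up to the factor `± k!`. -/
theorem eq_zero_of_impSmooth_eq_zero {n : ℕ} {f : ℝ → Fin n → ℝ} (hf : ContDiff ℝ ∞ f)
    {a : ℕ →₀ (Fin n → ℝ)} (h : impSmooth f a = 0) : a = 0 := by
  have h1 : a.sum diracDeriv = 0 := by
    simpa [impSmooth, regDist_eq_zero_of_impSmooth_eq_zero hf h] using h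
  ext1 k
  obtain ⟨φ, hφ⟩ := exists_testFunction_eq_pow k
  have h2 : a.sum diracDeriv φ = 0 := by rw [h1]; rfl
  rw [sum_diracDeriv_apply, Finsupp.sum_eq_single k] at h2
  · rw [hφ.iteratedDeriv_eq, iteratedDeriv_fun_pow_zero] at h2
    simpa [Nat.factorial_ne_zero] using h2
  · intro i _ hik
    rw [hφ.iteratedDeriv_eq, iteratedDeriv_fun_pow_zero]
    simp [hik]
  · simp

/-- This is what turns the distributional state and output equations into algebraic equations
between impulse coefficients. -/
theorem impSmooth_coeff_unique {n : ℕ} {f g : ℝ → Fin n → ℝ} (hf : ContDiff ℝ ∞ f)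
    (hg : ContDiff ℝ ∞ g) {a b : ℕ →₀ (Fin n → ℝ)} (h : impSmooth f a = impSmooth g b) :
    a = b := by
  have hg' : ContDiff ℝ ∞ ((-1 : ℝ) • g) := hg.const_smul (-1 : ℝ)
  have h1 : impSmooth (f + (-1 : ℝ) • g) (a + (-1 : ℝ) • b) = 0 := by
    rw [impSmooth_add hf hg', impSmooth_smul _ hg, h]
    simp
  have h2 := eq_zero_of_impSmooth_eq_zero (hf.add hg') h1
  rwa [neg_smul, one_smul, ← sub_eq_add_neg, sub_eq_zero] at h2

/-! ### Fitting decomposition -/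

section Fitting

variable {V : Type*} [AddCommGroup V] [Module ℝ V]

/-- The eventual range `⋂ₖ Rᵏ(V)` of an endomorphism. -/
def eventualRange (R : Module.End ℝ V) : Submodule ℝ V :=
  ⨅ k : ℕ, LinearMap.range (R ^ k)

theorem mem_maxGenEigenspace_zero {R : Module.End ℝ V} {v : V} :
    v ∈ R.maxGenEigenspace 0 ↔ ∃ k : ℕ, (R ^ k) v = 0 := by
  simp [Module.End.mem_maxGenEigenspace]

theorem map_mem_maxGenEigenspace_zero_iff {R : Module.End ℝ V} {v : V} :
    R v ∈ R.maxGenEigenspace 0 ↔ v ∈ R.maxGenEigenspace 0 := by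
  simp only [mem_maxGenEigenspace_zero]
  constructor
  · rintro ⟨k, hk⟩
    exact ⟨k + 1, by rwa [pow_succ, Module.End.mul_apply]⟩
  · rintro ⟨k, hk⟩
    exact ⟨k, by rw [← Module.End.mul_apply, ← pow_succ, pow_succ', Module.End.mul_apply, hk,
      map_zero]⟩

theorem map_mem_eventualRange {R : Module.End ℝ V} {v : V} (hv : v ∈ eventualRange R) :
    R v ∈ eventualRange R := by
  rw [eventualRange, Submodule.mem_iInf] at *
  intro k
  obtain ⟨w, rfl⟩ := hv k
  exact ⟨R w, by rw [← Module.End.mul_apply, ← pow_succ, pow_succ', Module.End.mul_apply]⟩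

variable [FiniteDimensional ℝ V]

theorem isCompl_maxGenEigenspace_zero_eventualRange (R : Module.End ℝ V) :
    IsCompl (R.maxGenEigenspace 0) (eventualRange R) := by
  have h : R.maxGenEigenspace 0 = ⨆ k : ℕ, LinearMap.ker (R ^ k) := by
    simp [← Module.End.iSup_genEigenspace_eq, Module.End.genEigenspace_nat]
  rw [h]
  exact LinearMap.isCompl_iSup_ker_pow_iInf_range_pow R

theorem ker_restrict_eventualRange (R : Module.End ℝ V) :
    LinearMap.ker (R.restrict fun _ => map_mem_eventualRange (R := R)) = ⊥ := by
  rw [LinearMap.ker_eq_bot']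
  rintro ⟨v, hv⟩ h
  have h' : R v = 0 := congrArg Subtype.val h
  have h0 : v ∈ R.maxGenEigenspace 0 := mem_maxGenEigenspace_zero.2 ⟨1, by simpa using h'⟩
  exact Subtype.ext <| Submodule.disjoint_def.1
    (isCompl_maxGenEigenspace_zero_eventualRange R).disjoint v h0 hv

/-- The bijection induced by `R` on its eventual range. -/
def eventualRangeEquiv (R : Module.End ℝ V) : eventualRange R ≃ₗ[ℝ] eventualRange R :=
  LinearEquiv.ofInjectiveEndo _ (LinearMap.ker_eq_bot.1 (ker_restrict_eventualRange R))

theorem map_eventualRangeEquiv_symm (R : Module.End ℝ V) (v : eventualRange R) :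
    R ((eventualRangeEquiv R).symm v) = v :=
  congrArg Subtype.val ((eventualRangeEquiv R).apply_symm_apply v)

theorem finrank_map_add_finrank_inf_ker {W : Type*} [AddCommGroup W] [Module ℝ W]
    (f : V →ₗ[ℝ] W) (U : Submodule ℝ V) :
    Module.finrank ℝ (U.map f) + Module.finrank ℝ (U ⊓ LinearMap.ker f : Submodule ℝ V) =
      Module.finrank ℝ U := by
  have h := (f.domRestrict U).finrank_range_add_finrank_ker
  rw [LinearMap.range_domRestrict, LinearMap.ker_domRestrict, ← Submodule.finrank_map_subtype_eq,
    Submodule.map_comap_subtype] at h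
  exact h

end Fitting

/-! ### Finite chains -/

section Chain

variable {V : Type*} [AddCommGroup V] [Module ℝ V]

/-- Descending induction from the zero tail: if `s (i + 1)` is in the generalized null space, so is
`R (s i)`, hence `s i`. -/
theorem mem_maxGenEigenspace_of_chain {R : Module.End ℝ V} {lam : ℝ} {s : ℕ → V} {k : ℕ}
    (h0 : ∀ i, k ≤ i → s i = 0) (h : ∀ i, R (s i) = s (i + 1) + lam • R (s (i + 1))) (i : ℕ) :
    s i ∈ R.maxGenEigenspace 0 := by
  suffices H : ∀ j i, k ≤ i + j → s i ∈ R.maxGenEigenspace 0 from H k i (Nat.le_add_left _ _)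
  intro j
  induction j with
  | zero => intro i hi; rw [h0 i hi]; exact zero_mem _
  | succ j ih =>
    intro i hi
    have h1 := ih (i + 1) (by omega)
    rw [← map_mem_maxGenEigenspace_zero_iff, h]
    exact add_mem h1 (Submodule.smul_mem _ _ (map_mem_maxGenEigenspace_zero_iff.2 h1))

/-- The next term must be `(1 + λR)⁻¹ R v`; the inverse exists on the generalized null space, and
each step lowers the nilpotency exponent by one. -/
theorem exists_chain_of_pow_apply_eq_zero (R : Module.End ℝ V) (lam : ℝ) (k : ℕ) (v : V)
    (hv : (R ^ k) v = 0) :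
    ∃ s : ℕ → V, s 0 = v ∧ (∀ i, k ≤ i → s i = 0) ∧
      ∀ i, R (s i) = s (i + 1) + lam • R (s (i + 1)) := by
  induction k generalizing v with
  | zero =>
    have : v = 0 := by simpa using hv
    exact ⟨0, this.symm, fun _ _ => rfl, fun i => by simp⟩
  | succ k ih =>
    let T : Module.End ℝ V := -(lam • R)
    -- Neumann series of `(1 + λR)⁻¹` applied to `R v`, finite because `R ^ k` kills `R v`.
    let w : V := (∑ i ∈ Finset.range k, T ^ i) (R v)
    have hcomm : Commute (R ^ k) (∑ i ∈ Finset.range k, T ^ i) :=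
      Commute.sum_right _ _ _ fun i _ =>
        (((Commute.refl R).smul_right lam).neg_right.pow_pow k i)
    have hRv : (R ^ k) (R v) = 0 := by rwa [← Module.End.mul_apply, ← pow_succ]
    have hw : (R ^ k) w = 0 := by
      rw [← Module.End.mul_apply, hcomm.eq, Module.End.mul_apply, hRv, map_zero]
    have hTk : (T ^ k) (R v) = 0 := by
      have : T ^ k = (-lam) ^ k • R ^ k := by
        rw [← _root_.smul_pow, neg_smul]
      rw [this, LinearMap.smul_apply, hRv, smul_zero]
    have hw' : R v = w + lam • R w := by
      have h := LinearMap.congr_fun (mul_neg_geom_sum T k) (R v)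
      rw [LinearMap.sub_apply, hTk, Module.End.one_apply, sub_zero] at h
      rw [← h]
      simp only [T, w, sub_neg_eq_add, add_mul, one_mul, LinearMap.add_apply,
        Module.End.mul_apply, LinearMap.smul_apply]
    obtain ⟨s, hs0, hs, hs'⟩ := ih w hw
    refine ⟨fun i => Nat.casesOn i v s, rfl, ?_, ?_⟩
    · rintro (_ | i) hi
      · omega
      · exact hs i (by omega)
    · rintro (_ | i)
      · change R v = s 0 + lam • R (s 0)
        rw [hs0, ← hw']
      · exact hs' i

end Chain

/-! ### Linear flows -/

section Flow

variable {V : Type*} [NormedAddCommGroup V] [NormedSpace ℝ V] [FiniteDimensional ℝ V]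

theorem exists_linear_flow (Q : Module.End ℝ V) (v : V) :
    ∃ z : ℝ → V, ContDiff ℝ ∞ z ∧ z 0 = v ∧ ∀ t, HasDerivAt z (Q (z t)) t := by
  have := FiniteDimensional.complete ℝ V
  let q : V →L[ℝ] V := LinearMap.toContinuousLinearMap Q
  have hc : ContDiff ℝ ∞ fun t : ℝ => NormedSpace.exp (t • q) := by
    have h : ContDiff ℝ ∞ (NormedSpace.exp : (V →L[ℝ] V) → V →L[ℝ] V) :=
      contDiff_iff_contDiffAt.2 fun x => (NormedSpace.exp_analytic (𝕂 := ℝ) x).contDiffAt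
    exact h.comp (contDiff_id.smul contDiff_const)
  refine ⟨fun t => NormedSpace.exp (t • q) v, hc.clm_apply contDiff_const, by simp, fun t => ?_⟩
  exact (hasDerivAt_exp_smul_const' q t).clm_apply (hasDerivAt_const t v) |>.congr_deriv
    (by simp [q])

/-- On its eventual range `R` is invertible, so the implicit equation becomes the ordinary one `z' =
(R⁻¹ + λ) z`. -/
theorem exists_flow_of_mem_eventualRange (R : Module.End ℝ V) (lam : ℝ) {v : V}
    (hv : v ∈ eventualRange R) :
    ∃ z z' : ℝ → V, ContDiff ℝ ∞ z ∧ z 0 = v ∧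
      ∀ t, HasDerivAt z (z' t) t ∧ R (z' t) = z t + lam • R (z t) := by
  obtain ⟨z, hz, hz0, hz'⟩ := exists_linear_flow
    ((eventualRangeEquiv R).symm.toLinearMap + lam • LinearMap.id) ⟨v, hv⟩
  let ι := LinearMap.toContinuousLinearMap (eventualRange R).subtype
  refine ⟨fun t => z t, _, ι.contDiff.comp hz, congrArg Subtype.val hz0,
    fun t => ⟨ι.hasFDerivAt.comp_hasDerivAt t (hz' t), ?_⟩⟩
  simp [ι, map_eventualRangeEquiv_symm]

/-- A finite-dimensional subspace is closed, so it contains the limits of difference quotients of a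
curve lying in it. -/
theorem hasDerivWithinAt_Ici_mem {U : Submodule ℝ V} {z : ℝ → V} {z' : V} {t : ℝ} (ht : 0 ≤ t)
    (hz : ∀ r, 0 ≤ r → z r ∈ U) (h : HasDerivWithinAt z z' (Ici 0) t) : z' ∈ U := by
  have h1 := range_derivWithin_subset_closure_span_image z (s := Ici 0) (t := Ici 0)
    (by simp)
  have h2 : z' ∈ closure (Submodule.span ℝ (z '' Ici 0) : Set V) := by
    rw [← h.derivWithin (uniqueDiffOn_Ici 0 t ht)]
    exact h1 ⟨t, rfl⟩
  have h3 : Submodule.span ℝ (z '' Ici 0) ≤ U := by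
    rw [Submodule.span_le]
    rintro _ ⟨r, hr, rfl⟩
    exact hz r hr
  exact closure_minimal (show (Submodule.span ℝ (z '' Ici 0) : Set V) ⊆ U from h3)
    U.closed_of_finiteDimensional h2

/-- Bootstrapping: if the whole curve lies in the range of `R ^ k`, so does its derivative, and `z =
R (z' - λ z)` then lies in the range of `R ^ (k + 1)`. -/
theorem mem_eventualRange_of_flow {R : Module.End ℝ V} {lam : ℝ} {z z' : ℝ → V}
    (h : ∀ t, 0 ≤ t → HasDerivWithinAt z (z' t) (Ici 0) t ∧ R (z' t) = z t + lam • R (z t))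
    {t : ℝ} (ht : 0 ≤ t) : z t ∈ eventualRange R := by
  rw [eventualRange, Submodule.mem_iInf]
  intro k
  induction k generalizing t with
  | zero => simp
  | succ k ih =>
    obtain ⟨y, hy⟩ := ih ht
    obtain ⟨y', hy'⟩ := hasDerivWithinAt_Ici_mem ht (fun r hr => ih hr) (h t ht).1
    refine ⟨y' - lam • y, ?_⟩
    rw [pow_succ', Module.End.mul_apply, map_sub, map_smul, hy, hy', map_sub, (h t ht).2, map_smul]
    abel

end Flow

/-! ### Regular matrix pencils -/

section Pencil

variable {ι : Type*} [Fintype ι] [DecidableEq ι]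

/-- The operator `R` with `l E - K = (l₀ E - K) (1 - (l - l₀) R)`. -/
def pencilOp (E K : Matrix ι ι ℝ) (lam : ℝ) : Matrix ι ι ℝ :=
  -((lam • E - K)⁻¹ * E)

/-- Multiply by `P⁻¹`, where `P = λE - K`: then `P⁻¹E = -R` and `P⁻¹K = -(1 + λR)`. -/
theorem pencil_mulVec_eq_iff {E K : Matrix ι ι ℝ} {lam : ℝ} (h : IsUnit (lam • E - K).det)
    (a b : ι → ℝ) :
    E.mulVec a = K.mulVec b ↔
      (pencilOp E K lam).mulVecLin a = b + lam • (pencilOp E K lam).mulVecLin b := by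
  have hP := Matrix.nonsing_inv_mul _ h
  have hP' := Matrix.mul_nonsing_inv _ h
  set P := lam • E - K with hPdef
  have hK : K = lam • E - P := by rw [hPdef]; abel
  have e1 : (pencilOp E K lam).mulVecLin a = -P⁻¹.mulVec (E.mulVec a) := by
    rw [Matrix.mulVecLin_apply, pencilOp, Matrix.neg_mulVec, Matrix.mulVec_mulVec]
  have e2 : b + lam • (pencilOp E K lam).mulVecLin b = -P⁻¹.mulVec (K.mulVec b) := by
    rw [Matrix.mulVecLin_apply, pencilOp, ← hPdef, Matrix.mulVec_mulVec, hK, Matrix.mul_sub, hP,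
      Matrix.sub_mulVec, Matrix.one_mulVec, Matrix.mul_smul, Matrix.neg_mulVec,
      Matrix.smul_mulVec]
    module
  rw [e1, e2, neg_inj]
  refine ⟨fun h => by rw [h], fun h => ?_⟩
  have := congrArg P.mulVec h
  simpa only [Matrix.mulVec_mulVec, ← Matrix.mul_assoc, hP', Matrix.one_mul] using this

/-- From `sE - K = (λE - K)(1 - (s - λ)R)`, the determinant is a nonzero constant times the reversed
characteristic polynomial of `R` at `s - λ`. Reversal lowers the degree by the multiplicity of the
root `0`, which is the dimension of the generalized null space. -/
theorem finrank_eventualRange_pencilOp {E K : Matrix ι ι ℝ} {lam : ℝ}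
    (h : IsUnit (lam • E - K).det) :
    Module.finrank ℝ (eventualRange (pencilOp E K lam).mulVecLin) =
      ((X : ℝ[X]) • E.map C - K.map C).det.natDegree := by
  have h1 := Submodule.finrank_add_eq_of_isCompl
    (isCompl_maxGenEigenspace_zero_eventualRange (pencilOp E K lam).mulVecLin)
  rw [LinearMap.finrank_maxGenEigenspace_zero_eq, Matrix.charpoly_mulVecLin] at h1
  have hP' := Matrix.mul_nonsing_inv _ h
  have hfac : (X : ℝ[X]) • E.map C - K.map C = (lam • E - K).map C *
      (1 - (X - C lam : ℝ[X]) • (pencilOp E K lam).map C) := by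
    have e : (lam • E - K).map C * (pencilOp E K lam).map C = -E.map C := by
      rw [← Matrix.map_mul, pencilOp, Matrix.mul_neg, ← Matrix.mul_assoc, hP', Matrix.one_mul]
      ext i j; simp
    rw [Matrix.mul_sub, Matrix.mul_one, Matrix.mul_smul, e]
    ext i j
    simp
    ring
  have hcomp : (1 - (X - C lam : ℝ[X]) • (pencilOp E K lam).map C).det =
      (pencilOp E K lam).charpolyRev.comp (X - C lam) := by
    rw [Matrix.charpolyRev, ← Polynomial.coe_compRingHom_apply, RingHom.map_det]
    congr 1
    refine Matrix.ext fun i j => ?_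
    by_cases hij : i = j
    · subst hij; simp; ring
    · simp [hij]; ring
  -- The shift by `λ` and the constant factor leave the degree unchanged; what remains is full
  -- dimension minus the trailing degree.
  rw [hfac, Matrix.det_mul, hcomp, ← RingHom.mapMatrix_apply, ← RingHom.map_det,
    natDegree_C_mul h.ne_zero, natDegree_comp, natDegree_X_sub_C, mul_one,
    ← Matrix.reverse_charpoly, reverse_natDegree, Matrix.charpoly_natDegree_eq_dim]
  rw [Module.finrank_fintype_fun_eq_card] at h1
  omega

end Pencil

/-! ### The system pencil -/

namespace StateSpace

variable {N M : ℕ}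

/-- The singular coefficient `diag(I, 0)` of the system pencil. -/
def pencilE (N M : ℕ) : Matrix (Fin N ⊕ Fin M) (Fin N ⊕ Fin M) ℝ :=
  Matrix.fromBlocks 1 0 0 0

/-- The constant coefficient of the system pencil. -/
def pencilK (S : StateSpace N M M) : Matrix (Fin N ⊕ Fin M) (Fin N ⊕ Fin M) ℝ :=
  Matrix.fromBlocks S.A S.B (-S.C) (-S.D)

/-- Schur complement of the block `sI - A`, computed over `ℝ(s)` where that block is invertible. -/
theorem numDet_eq_det_pencil (S : StateSpace N M M) :
    S.numDet = ((X : ℝ[X]) • (pencilE N M).map Polynomial.C - S.pencilK.map Polynomial.C).det := by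
  have hdet : ((RatFunc.X : RatFunc ℝ) • 1 - S.A.map RatFunc.C).det =
      algebraMap ℝ[X] (RatFunc ℝ) S.A.charpoly := by
    rw [← charmatrix_map, Matrix.charpoly, RingHom.map_det, RingHom.mapMatrix_apply]
  have hne : algebraMap ℝ[X] (RatFunc ℝ) S.A.charpoly ≠ 0 := by
    simpa using S.A.charpoly_monic.ne_zero
  have hu : IsUnit ((RatFunc.X : RatFunc ℝ) • 1 - S.A.map RatFunc.C) := by
    rw [Matrix.isUnit_iff_isUnit_det, hdet]
    exact hne.isUnit
  let _ : Invertible ((RatFunc.X : RatFunc ℝ) • 1 - S.A.map RatFunc.C) := hu.invertible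
  have hblock : ((X : ℝ[X]) • (pencilE N M).map Polynomial.C - S.pencilK.map Polynomial.C).map
      (algebraMap ℝ[X] (RatFunc ℝ)) =
      Matrix.fromBlocks ((RatFunc.X : RatFunc ℝ) • 1 - S.A.map RatFunc.C) (-(S.B.map RatFunc.C))
        (S.C.map RatFunc.C) (S.D.map RatFunc.C) := by
    ext (i | i) (j | j)
    · by_cases h : i = j
      · subst h; simp [pencilE, pencilK]
      · simp [pencilE, pencilK, h]
    all_goals simp [pencilE, pencilK]
  apply RatFunc.algebraMap_injective ℝ
  rw [algebraMap_numDet, RingHom.map_det, RingHom.mapMatrix_apply, hblock,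
    Matrix.det_fromBlocks₁₁, hdet, transferMatrix, Matrix.invOf_eq_nonsing_inv, Matrix.mul_neg,
    sub_neg_eq_add, add_comm]

theorem numDet_ne_zero {S : StateSpace N M M} (hG : IsUnit S.transferMatrix) : S.numDet ≠ 0 := by
  intro h
  have h1 := S.algebraMap_numDet
  rw [h, map_zero, eq_comm, mul_eq_zero] at h1
  rcases h1 with h1 | h1
  · exact S.A.charpoly_monic.ne_zero (by simpa using h1)
  · exact ((Matrix.isUnit_iff_isUnit_det _).1 hG).ne_zero h1

/-- A nonzero real polynomial cannot vanish at every real number. -/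
theorem exists_isUnit_det_pencil {S : StateSpace N M M} (hG : IsUnit S.transferMatrix) :
    ∃ lam : ℝ, IsUnit (lam • pencilE N M - S.pencilK).det := by
  by_contra! H
  refine numDet_ne_zero hG (Polynomial.funext fun lam => ?_)
  have h := H lam
  rw [isUnit_iff_ne_zero, not_not] at h
  rw [numDet_eq_det_pencil, ← Polynomial.coe_evalRingHom, RingHom.map_det, map_zero, ← h]
  congr 1
  ext i j
  simp
  ring

/-- The projection of the pair of a state and an input to the state. -/
def statePart (N M : ℕ) : (Fin N ⊕ Fin M → ℝ) →ₗ[ℝ] (Fin N → ℝ) :=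
  LinearMap.funLeft ℝ ℝ Sum.inl

theorem pencilE_mulVec (a : Fin N ⊕ Fin M → ℝ) :
    (pencilE N M).mulVec a = Sum.elim (a ∘ Sum.inl) 0 := by
  rw [pencilE, Matrix.fromBlocks_mulVec]
  simp

theorem pencil_eq_iff (S : StateSpace N M M) (a b : Fin N ⊕ Fin M → ℝ) :
    (pencilE N M).mulVec a = S.pencilK.mulVec b ↔
      a ∘ Sum.inl = S.A.mulVec (b ∘ Sum.inl) + S.B.mulVec (b ∘ Sum.inr) ∧
        S.C.mulVec (b ∘ Sum.inl) + S.D.mulVec (b ∘ Sum.inr) = 0 := by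
  rw [pencilE_mulVec, pencilK, Matrix.fromBlocks_mulVec, Sum.elim_eq_iff]
  refine and_congr_right fun _ => ?_
  rw [Matrix.neg_mulVec, Matrix.neg_mulVec, ← neg_add, eq_comm, neg_eq_zero]

/-- Vectors with zero state part are killed by `E`, hence already by `R`. -/
theorem ker_statePart_le (S : StateSpace N M M) {lam : ℝ}
    (h : IsUnit (lam • pencilE N M - S.pencilK).det) :
    LinearMap.ker (statePart N M) ≤
      Module.End.maxGenEigenspace (pencilOp (pencilE N M) S.pencilK lam).mulVecLin 0 := by
  intro a ha
  have ha' : a ∘ Sum.inl = 0 := ha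
  refine mem_maxGenEigenspace_zero.2 ⟨1, ?_⟩
  have h1 := (pencil_mulVec_eq_iff h a 0).1 (by
    rw [pencilE_mulVec, ha', Matrix.mulVec_zero]
    ext (i | i) <;> rfl)
  simpa using h1

/-- The weakly unobservable subspace is the projection of the finite deflating subspace of the
system pencil. -/
theorem weaklyUnobservable_eq (S : StateSpace N M M) {lam : ℝ}
    (h : IsUnit (lam • pencilE N M - S.pencilK).det) :
    S.weaklyUnobservable =
      (eventualRange (pencilOp (pencilE N M) S.pencilK lam).mulVecLin).map (statePart N M) := by
  ext x₀
  constructor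
  · rintro ⟨u, hu, x, ⟨hx0, hx⟩, hy⟩
    let z : ℝ → Fin N ⊕ Fin M → ℝ := fun t => Sum.elim (x t) (u t)
    -- The input component is invisible to `E`, but smoothness of `u` is needed for `z` to be
    -- differentiable.
    let z' : ℝ → Fin N ⊕ Fin M → ℝ := fun t =>
      Sum.elim (S.A.mulVec (x t) + S.B.mulVec (u t)) (deriv u t)
    refine ⟨z 0, mem_eventualRange_of_flow (z := z) (z' := z') (lam := lam) (fun t ht => ⟨?_, ?_⟩)
      le_rfl, hx0⟩
    · rw [hasDerivWithinAt_pi]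
      rintro (i | i)
      · exact hasDerivWithinAt_pi.1 (hx t ht) i
      · exact hasDerivWithinAt_pi.1
          (hu.differentiable (by simp) t).hasDerivAt.hasDerivWithinAt i
    · rw [← pencil_mulVec_eq_iff h, pencil_eq_iff]
      exact ⟨rfl, hy t ht⟩
  · rintro ⟨v, hv, rfl⟩
    obtain ⟨z, z', hz, hz0, hz'⟩ := exists_flow_of_mem_eventualRange _ lam hv
    have hflow := fun t => (pencil_eq_iff S _ _).1 ((pencil_mulVec_eq_iff h _ _).2 (hz' t).2)
    refine ⟨fun t => z t ∘ Sum.inr, ?_, fun t => z t ∘ Sum.inl, ⟨?_, fun t _ => ?_⟩,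
      fun t _ => (hflow t).2⟩
    · exact contDiff_pi.2 fun i => contDiff_pi.1 hz (Sum.inr i)
    · simp only [hz0]
      rfl
    · refine HasDerivAt.hasDerivWithinAt ?_
      rw [← (hflow t).1, hasDerivAt_pi]
      exact fun i => hasDerivAt_pi.1 (hz' t).1 (Sum.inl i)

/-- The equations satisfied by the impulsive coefficients of a trajectory from the origin. -/
theorem isDistTrajectory_impSmooth_coeff (S : StateSpace N M M) {f : ℝ → Fin M → ℝ}
    {g : ℝ → Fin N → ℝ} (hf : ContDiff ℝ ∞ f) (hg : ContDiff ℝ ∞ g) {a : ℕ →₀ (Fin M → ℝ)}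
    {b : ℕ →₀ (Fin N → ℝ)} (h : S.IsDistTrajectory 0 (impSmooth f a) (impSmooth g b)) :
    g 0 = S.A.mulVec (b 0) + S.B.mulVec (a 0) ∧
      ∀ i, b i = S.A.mulVec (b (i + 1)) + S.B.mulVec (a (i + 1)) := by
  unfold IsDistTrajectory at h
  have hA := contDiff_mulVec S.A hg
  have hB := contDiff_mulVec S.B hf
  rw [diracDeriv_zero, add_zero, matDist_impSmooth S.A hg, matDist_impSmooth S.B hf,
    ← impSmooth_add hA hB, lineDeriv_impSmooth hg] at h
  have h1 := impSmooth_coeff_unique (contDiff_infty_iff_deriv.1 hg).2 (hA.add hB) h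
  constructor
  · have h2 := DFunLike.congr_fun h1 0
    rw [Finsupp.add_apply, Finsupp.mapDomain_of_notMem_range _ _ (by simp)] at h2
    simpa using h2
  · intro i
    have h2 := DFunLike.congr_fun h1 (i + 1)
    rw [Finsupp.add_apply, ← Nat.succ_eq_add_one,
      Finsupp.mapDomain_apply Nat.succ_injective] at h2
    simpa using h2

theorem isRegularDist_output_coeff (S : StateSpace N M M) {f : ℝ → Fin M → ℝ}
    {g : ℝ → Fin N → ℝ} (hf : ContDiff ℝ ∞ f) (hg : ContDiff ℝ ∞ g) {a : ℕ →₀ (Fin M → ℝ)}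
    {b : ℕ →₀ (Fin N → ℝ)}
    (h : IsRegularDist (matDist S.C (impSmooth g b) + matDist S.D (impSmooth f a))) (i : ℕ) :
    S.C.mulVec (b i) + S.D.mulVec (a i) = 0 := by
  obtain ⟨y, hy, h⟩ := h
  have hC := contDiff_mulVec S.C hg
  have hD := contDiff_mulVec S.D hf
  have hy' : regDist y = impSmooth y 0 := by simp [impSmooth]
  rw [matDist_impSmooth S.C hg, matDist_impSmooth S.D hf, ← impSmooth_add hC hD, hy'] at h
  simpa using DFunLike.congr_fun (impSmooth_coeff_unique (hC.add hD) hy h) i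

/-- With no smooth input, the regular part evolves freely; the impulses only have to set its initial
value. -/
theorem isDistTrajectory_of_coeff (S : StateSpace N M M) {g : ℝ → Fin N → ℝ}
    (hg : ContDiff ℝ ∞ g) (hg' : ∀ t, HasDerivAt g (S.A.mulVec (g t)) t)
    {a : ℕ →₀ (Fin M → ℝ)} {b : ℕ →₀ (Fin N → ℝ)}
    (h0 : g 0 = S.A.mulVec (b 0) + S.B.mulVec (a 0))
    (h : ∀ i, b i = S.A.mulVec (b (i + 1)) + S.B.mulVec (a (i + 1))) :
    S.IsDistTrajectory 0 (impSmooth 0 a) (impSmooth g b) := by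
  have hf : ContDiff ℝ ∞ (0 : ℝ → Fin M → ℝ) := contDiff_const
  have hA := contDiff_mulVec S.A hg
  have hB := contDiff_mulVec S.B hf
  rw [IsDistTrajectory, diracDeriv_zero, add_zero, matDist_impSmooth S.A hg,
    matDist_impSmooth S.B hf, ← impSmooth_add hA hB, lineDeriv_impSmooth hg]
  congr 1
  · ext1 t
    simp [(hg' t).deriv]
  · ext1 i
    cases i with
    | zero =>
      rw [Finsupp.add_apply, Finsupp.mapDomain_of_notMem_range _ _ (by simp)]
      simpa using h0
    | succ i =>
      rw [Finsupp.add_apply, ← Nat.succ_eq_add_one, Finsupp.mapDomain_apply Nat.succ_injective]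
      simpa using h i

theorem isRegularDist_output_of_coeff (S : StateSpace N M M) {f : ℝ → Fin M → ℝ}
    {g : ℝ → Fin N → ℝ} (hf : ContDiff ℝ ∞ f) (hg : ContDiff ℝ ∞ g) {a : ℕ →₀ (Fin M → ℝ)}
    {b : ℕ →₀ (Fin N → ℝ)} (h : ∀ i, S.C.mulVec (b i) + S.D.mulVec (a i) = 0) :
    IsRegularDist (matDist S.C (impSmooth g b) + matDist S.D (impSmooth f a)) := by
  have hC := contDiff_mulVec S.C hg
  have hD := contDiff_mulVec S.D hf
  refine ⟨_, hC.add hD, ?_⟩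
  rw [matDist_impSmooth S.C hg, matDist_impSmooth S.D hf, ← impSmooth_add hC hD]
  have : b.mapRange S.C.mulVec (Matrix.mulVec_zero S.C) +
      a.mapRange S.D.mulVec (Matrix.mulVec_zero S.D) = 0 := by
    ext1 i
    simpa using h i
  rw [this]
  simp [impSmooth]
  rfl

/-- The strongly reachable subspace is the projection of the infinite deflating subspace of the
system pencil. -/
theorem stronglyReachable_eq (S : StateSpace N M M) {lam : ℝ}
    (h : IsUnit (lam • pencilE N M - S.pencilK).det) :
    S.stronglyReachable = (Module.End.maxGenEigenspace
      (pencilOp (pencilE N M) S.pencilK lam).mulVecLin 0).map (statePart N M) := by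
  ext x₁
  constructor
  · rintro ⟨u, x, ⟨f, a, hf, rfl⟩, hx, ⟨g, b, hg, rfl, hg0⟩, hy⟩
    have hcoeff := S.isDistTrajectory_impSmooth_coeff hf hg hx
    have hout := S.isRegularDist_output_coeff hf hg hy
    obtain ⟨k, hk⟩ := (a.support ∪ b.support).exists_nat_subset_range
    -- Shifted by one: the head carries `x(0⁺)`, with an arbitrary input part since `E` ignores it,
    -- and the coefficients of `δ⁽ⁱ⁾` sit at place `i + 1`.
    let s : ℕ → Fin N ⊕ Fin M → ℝ := fun i =>
      Nat.casesOn i (Sum.elim (g 0) 0) fun i => Sum.elim (b i) (a i)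
    refine ⟨s 0, mem_maxGenEigenspace_of_chain (s := s) (lam := lam) (k := k + 1) ?_ ?_ 0, hg0⟩
    · rintro (_ | i) hi
      · omega
      · have hi' : i ∉ a.support ∪ b.support := fun hh => by
          have := Finset.mem_range.1 (hk hh)
          omega
        simp only [Finset.mem_union, Finsupp.mem_support_iff, not_or, not_not] at hi'
        change Sum.elim (b i) (a i) = 0
        rw [hi'.1, hi'.2]
        exact Sum.elim_zero_zero
    · intro i
      rw [← pencil_mulVec_eq_iff h, pencil_eq_iff]
      cases i with
      | zero => exact ⟨hcoeff.1, hout 0⟩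
      | succ i => exact ⟨hcoeff.2 i, hout (i + 1)⟩
  · rintro ⟨v, hv, rfl⟩
    obtain ⟨k, hk⟩ := mem_maxGenEigenspace_zero.1 hv
    obtain ⟨s, hs0, hs, hs'⟩ := exists_chain_of_pow_apply_eq_zero _ lam k v hk
    have hchain := fun i => (pencil_eq_iff S _ _).1 ((pencil_mulVec_eq_iff h _ _).2 (hs' i))
    -- After the impulses the input is zero, so the state follows the free flow from the state part
    -- of `v`.
    obtain ⟨g, hg, hg0, hg'⟩ := exists_linear_flow S.A.mulVecLin (statePart N M v)
    have hfin : ∀ i, s (i + 1) ≠ 0 → i ∈ Finset.range k := fun i hi => by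
      by_contra hik
      exact hi (hs _ (by simp at hik; omega))
    let a : ℕ →₀ (Fin M → ℝ) := Finsupp.onFinset (Finset.range k) (fun i => s (i + 1) ∘ Sum.inr)
      fun i hi => hfin i fun h0 => hi (by rw [h0]; rfl)
    let b : ℕ →₀ (Fin N → ℝ) := Finsupp.onFinset (Finset.range k) (fun i => s (i + 1) ∘ Sum.inl)
      fun i hi => hfin i fun h0 => hi (by rw [h0]; rfl)
    refine ⟨impSmooth 0 a, impSmooth g b, ⟨0, a, contDiff_const, rfl⟩,
      S.isDistTrajectory_of_coeff hg hg' ?_ fun i => (hchain (i + 1)).1, ⟨g, b, hg, rfl, hg0⟩,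
      S.isRegularDist_output_of_coeff contDiff_const hg fun i => (hchain i).2⟩
    rw [hg0, ← hs0]
    exact (hchain 0).1

end StateSpace

end

/-! ### Dimension count -/

theorem mainTheorem4 (N M : ℕ) (Θ : StateSpace N M M) (hG : IsUnit Θ.transferMatrix) :
    Module.finrank ℝ Θ.weaklyUnobservable = Θ.numDet.natDegree ∧
      (Module.finrank ℝ Θ.stronglyReachable : ℤ) = (N : ℤ) - (Θ.numDet.natDegree : ℤ) := by
  obtain ⟨lam, h⟩ := StateSpace.exists_isUnit_det_pencil hG
  have hker := Θ.ker_statePart_le h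
  have hdeg := finrank_eventualRange_pencilOp h
  rw [← StateSpace.numDet_eq_det_pencil] at hdeg
  rw [Θ.weaklyUnobservable_eq h, Θ.stronglyReachable_eq h]
  have hcompl := isCompl_maxGenEigenspace_zero_eventualRange
    (pencilOp (StateSpace.pencilE N M) Θ.pencilK lam).mulVecLin
  have hsum := Submodule.finrank_add_eq_of_isCompl hcompl
  have h1 := finrank_map_add_finrank_inf_ker (StateSpace.statePart N M)
    (eventualRange (pencilOp (StateSpace.pencilE N M) Θ.pencilK lam).mulVecLin)
  have h2 := finrank_map_add_finrank_inf_ker (StateSpace.statePart N M)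
    (Module.End.maxGenEigenspace (pencilOp (StateSpace.pencilE N M) Θ.pencilK lam).mulVecLin 0)
  have h3 := (StateSpace.statePart N M).finrank_range_add_finrank_ker
  -- The kernel of the projection meets the eventual range trivially and lies entirely in the
  -- generalized null space.
  rw [(hcompl.symm.disjoint.mono_right hker).eq_bot, finrank_bot] at h1
  rw [inf_eq_right.2 hker] at h2
  have hsurj : Function.Surjective (StateSpace.statePart N M) :=
    LinearMap.funLeft_surjective_of_injective ℝ ℝ _ Sum.inl_injective
  rw [LinearMap.range_eq_top.2 hsurj, finrank_top] at h3
  simp only [Module.finrank_fintype_fun_eq_card, Fintype.card_sum, Fintype.card_fin] at h3 hsum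
  omega
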